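/- Let $0<R_1\le R_2$, $\lambda\ge 0$, $\lambda_e>0$, $\beta_e\ge 0$ and $\alpha\in\{2,4\}$ be fixed. For $D\ge R_2$ consider the following random network on the disk $\mathcal B(o,D)\subset\mathbb R^2$ of radius $D$ about the origin $o$. A transmitter is located at $o$; legitimate nodes and eavesdroppers form independent homogeneous Poisson point processes $\Phi$ and $\Phi_E$ on $\mathcal B(o,D)$ with intensities $\lambda$ and $\lambda_e$. Every $x\in\Phi$ with $\|x\|\le R_1$ is a jammer; every $x\in\Phi$ with $R_1<\|x\|\le R_2$ is, independently, a jammer with probability $P(\|x\|)$, where $$P(r)=p\ \text{ for a fixed } p\in[0,1]\ \text{(Policy E)},\qquad P(r)=\frac{r^\alpha-R_1^\alpha}{R_2^\alpha-R_1^\alpha}\ \text{(Policy I)},\qquad P(r)=\frac{R_2^\alpha-r^\alpha}{R_2^\alpha-R_1^\alpha}\ \text{(Policy D)};$$ no other node is a jammer. Let $\Phi_J$ be the set of jammers. The fading coefficients $h_{o,z}$ and $h_{x,z}$ ($z\in\Phi_E$, $x\in\Phi$) are i.i.d. exponential with mean $1$, independent of the node locations and of the selection of the jammers. For $z\in\Phi_E$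 put $$\mathrm{SIR}_z=\frac{h_{o,z}\|z\|^{-\alpha}}{\sum_{x\in\Phi_J}h_{x,z}\|x-z\|^{-\alpha}}\in[0,\infty]$$ (equal to $\infty$ if there is no jammer), and let $p_{so}(D)=\mathbb P\left(\exists z\in\Phi_E:\ \mathrm{SIR}_z>\beta_e\right)$ be the secrecy outage probability. Then, under each of the policies E, I and D, and for both $\alpha=2$ and $\alpha=4$, $$\lim_{D\to\infty}p_{so}(D)=1.$$ -/

import Mathlib

open MeasureTheory ProbabilityTheory Filter Topology
open scoped ENNReal NNReal

noncomputable section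

namespace FriendlyJamming

/-- The Euclidean plane. The transmitter sits at the origin `0`. -/
abbrev Plane : Type := EuclideanSpace ℝ (Fin 2)

/-- Number of points of the finite configuration `X 0 ω, …, X (N ω - 1) ω` lying in `A`. -/
def pointCount {Ω : Type*} (N : Ω → ℕ) (X : ℕ → Ω → Plane) (A : Set Plane) (ω : Ω) : ℕ :=
  Set.ncard {i : ℕ | i < N ω ∧ X i ω ∈ A}

/-- The random finite configuration `X 0, …, X (N - 1)` is a Poisson point process with (finite)
intensity measure `ν`: the number of points in a Borel set `A` is Poisson with mean `ν A`, and the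
numbers of points in finitely many pairwise disjoint Borel sets are independent. The enumeration
of the points is arbitrary. -/
structure IsPoissonProcess {Ω : Type*} [MeasurableSpace Ω] (P : Measure Ω)
    (N : Ω → ℕ) (X : ℕ → Ω → Plane) (ν : Measure Plane) : Prop where
  measurable_num : Measurable N
  measurable_point : ∀ i, Measurable (X i)
  hasLaw_count : ∀ A : Set Plane, MeasurableSet A →
    HasLaw (pointCount N X A) (poissonMeasure (ν A).toNNReal) P
  indep_count : ∀ (n : ℕ) (A : Fin n → Set Plane), (∀ k, MeasurableSet (A k)) →
    Pairwise (Function.onFun Disjoint A) → iIndepFun (fun k => pointCount N X (A k)) P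

/-- The sigma-algebra generated by an enumerated random finite configuration. -/
def configSigma {Ω : Type*} (N : Ω → ℕ) (X : ℕ → Ω → Plane) : MeasurableSpace Ω :=
  MeasurableSpace.comap N inferInstance ⊔ ⨆ i, MeasurableSpace.comap (X i) inferInstance

/-- The random quantities of the network: the legitimate nodes `x_i`, `i < numNodes`, the
eavesdroppers `z_j`, `j < numEaves`, the marks used to select the long-range jammers, the fading
coefficients `h_{o,z_j}` and the fading coefficients `h_{x_i,z_j}`. -/
structure Network (Ω : Type*) where
  /-- number of legitimate nodes -/
  numNodes : Ω → ℕ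
  /-- locations of the legitimate nodes -/
  node : ℕ → Ω → Plane
  /-- number of eavesdroppers -/
  numEaves : Ω → ℕ
  /-- locations of the eavesdroppers -/
  eave : ℕ → Ω → Plane
  /-- selection mark of the `i`-th legitimate node -/
  mark : ℕ → Ω → ℝ
  /-- fading coefficient from the transmitter to the `j`-th eavesdropper -/
  fadeTx : ℕ → Ω → ℝ
  /-- fading coefficient from the `i`-th legitimate node to the `j`-th eavesdropper -/
  fade : ℕ → ℕ → Ω → ℝ

/-- Labels of the mutually independent sources of randomness of the network. -/
inductive Source : Type
  | nodes
  | eaves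
  | mark (i : ℕ)
  | fadeTx (j : ℕ)
  | fade (i j : ℕ)

/-- The long-range jammer selection policies `E` (with selection probability `p`), `I`, `D`. -/
inductive Policy : Type
  | E (p : unitInterval)
  | I
  | D

/-- Probability with which a legitimate node at distance `r` from the transmitter, `R₁ < r ≤ R₂`,
is selected as a jammer. -/
def Policy.prob (Ξ : Policy) (α R₁ R₂ r : ℝ) : ℝ :=
  match Ξ with
  | .E p => (p : ℝ)
  | .I => (r ^ α - R₁ ^ α) / (R₂ ^ α - R₁ ^ α)
  | .D => (R₂ ^ α - r ^ α) / (R₂ ^ α - R₁ ^ α)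

namespace Network

variable {Ω : Type*} (net : Network Ω)

/-- The sigma-algebra generated by a source of randomness. -/
def sourceSigma : Source → MeasurableSpace Ω
  | .nodes => configSigma net.numNodes net.node
  | .eaves => configSigma net.numEaves net.eave
  | .mark i => MeasurableSpace.comap (net.mark i) inferInstance
  | .fadeTx j => MeasurableSpace.comap (net.fadeTx j) inferInstance
  | .fade i j => MeasurableSpace.comap (net.fade i j) inferInstance

/-- The probabilistic model on the disk of radius `D` about the origin: legitimate nodes and
eavesdroppers are homogeneous Poisson point processes of intensities `lam` and `lamE` on the disk,
selection marks are uniform on `[0, 1]`, fading coefficients are exponential with mean `1`, and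
the two processes and all marks and fading coefficients are mutually independent. -/
structure IsPoissonNetwork [MeasurableSpace Ω] (P : Measure Ω) (lam lamE : ℝ≥0) (D : ℝ) :
    Prop where
  nodes_poisson : IsPoissonProcess P net.numNodes net.node
    (lam • volume.restrict (Metric.closedBall (0 : Plane) D))
  eaves_poisson : IsPoissonProcess P net.numEaves net.eave
    (lamE • volume.restrict (Metric.closedBall (0 : Plane) D))
  measurable_mark : ∀ i, Measurable (net.mark i)
  mark_law : ∀ i, HasLaw (net.mark i) (volume.restrict (Set.Icc (0 : ℝ) 1)) P
  measurable_fadeTx : ∀ j, Measurable (net.fadeTx j)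
  fadeTx_law : ∀ j, HasLaw (net.fadeTx j) (expMeasure 1) P
  measurable_fade : ∀ i j, Measurable (net.fade i j)
  fade_law : ∀ i j, HasLaw (net.fade i j) (expMeasure 1) P
  indep : iIndep net.sourceSigma P

/-- The `i`-th legitimate node is a jammer: it lies in the circle of radius `R₁`, or it lies in the
annulus between `R₁` and `R₂` and is selected, which has probability `Ξ.prob α R₁ R₂ ‖x_i‖` given
its location. -/
def IsJammer (Ξ : Policy) (α R₁ R₂ : ℝ) (i : ℕ) (ω : Ω) : Prop :=
  i < net.numNodes ω ∧
    (‖net.node i ω‖ ≤ R₁ ∨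
      (R₁ < ‖net.node i ω‖ ∧ ‖net.node i ω‖ ≤ R₂ ∧
        net.mark i ω < Ξ.prob α R₁ R₂ ‖net.node i ω‖))

open Classical in
/-- Sum interference `∑ h_{x,z} ‖x - z‖ ^ (-α)` over the jammers `x`, at the `j`-th eavesdropper
`z`. -/
def interference (Ξ : Policy) (α R₁ R₂ : ℝ) (j : ℕ) (ω : Ω) : ℝ≥0∞ :=
  ∑ i ∈ (Finset.range (net.numNodes ω)).filter (fun i => net.IsJammer Ξ α R₁ R₂ i ω),
    ENNReal.ofReal (net.fade i j ω) * edist (net.node i ω) (net.eave j ω) ^ (-α)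

/-- Signal-to-interference ratio `h_{o,z} ‖z‖ ^ (-α) / I(z)` at the `j`-th eavesdropper `z`, with
values in `[0, ∞]`: it is infinite if there is signal but no interference. -/
def sir (Ξ : Policy) (α R₁ R₂ : ℝ) (j : ℕ) (ω : Ω) : ℝ≥0∞ :=
  ENNReal.ofReal (net.fadeTx j ω) * edist (0 : Plane) (net.eave j ω) ^ (-α) /
    net.interference Ξ α R₁ R₂ j ω

/-- Secrecy outage probability: the probability that the signal-to-interference ratio at one or
more eavesdroppers is above the threshold `βe`. -/
def sop [MeasurableSpace Ω] (P : Measure Ω) (Ξ : Policy) (α R₁ R₂ : ℝ) (βe : ℝ≥0) : ℝ :=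
  P.real {ω | ∃ j, j < net.numEaves ω ∧ (βe : ℝ≥0∞) < net.sir Ξ α R₁ R₂ j ω}

end Network

end FriendlyJamming

end

/-! Under every policy the jammers lie within `R₂` of the transmitter, so their number is bounded by
a Poisson variable whose law does not depend on `D`. Seen from an eavesdropper beyond `2 * R₂`, a
jammer is at least half as far as the transmitter, so its path gain exceeds the transmitter's by a
factor of at most `2 ^ α`. If there are at most `M` nearby nodes, an outage at such an eavesdropper
follows from one event on fading alone, whose probability has a positive lower bound depending on
`M` but not on the position (`lt_sir_of_mem_strongSignal`, `measure_strongSignal`). These events are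
independent over eavesdroppers and of the locations, and the number of far eavesdroppers tends to
infinity in probability. Hence an outage is avoided with vanishing probability
(`measure_no_outage_le`). -/

namespace FriendlyJamming

/-! ### Independence of grouped sources. -/

section Independence

variable {Ω ι κ : Type*} {mΩ : MeasurableSpace Ω} {P : Measure Ω}

/-- Events depending on pairwise disjoint groups of independent sources are independent. -/
theorem measure_inter_biInter_eq_mul_prod {m : ι → MeasurableSpace Ω} (h_le : ∀ i, m i ≤ mΩ)
    (hm : iIndep m P) {U : Set ι} {T : κ → Set ι} (hUT : ∀ j, Disjoint U (T j))
    (hT : Pairwise (Function.onFun Disjoint T)) {B : Set Ω} (hB : MeasurableSet[⨆ i ∈ U, m i] B)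
    {A : κ → Set Ω} (hA : ∀ j, MeasurableSet[⨆ i ∈ T j, m i] (A j)) (t : Finset κ) :
    P (B ∩ ⋂ j ∈ t, A j) = P B * ∏ j ∈ t, P (A j) := by
  classical
  induction t using Finset.induction_on with
  | empty => simp
  | insert k t hk ih =>
    have hdisj : Disjoint (U ∪ ⋃ j ∈ t, T j) (T k) := by
      rw [Set.disjoint_union_left, Set.disjoint_iUnion₂_left]
      exact ⟨hUT k, fun j hj => hT (ne_of_mem_of_not_mem hj hk)⟩
    have hmeas : MeasurableSet[⨆ i ∈ U ∪ ⋃ j ∈ t, T j, m i] (B ∩ ⋂ j ∈ t, A j) := by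
      refine MeasurableSet.inter ?_ (Finset.measurableSet_biInter _ fun j hj => ?_)
      · exact biSup_mono (f := m) (fun i hi => Or.inl hi) _ hB
      · exact biSup_mono (f := m) (fun i hi => Or.inr (Set.mem_biUnion hj hi)) _ (hA j)
    have hind := (Indep_iff _ _ _).1 (indep_iSup_of_disjoint h_le hm hdisj) _ _ hmeas (hA k)
    rw [Finset.set_biInter_insert, Finset.prod_insert hk, Set.inter_comm (A k), ← Set.inter_assoc,
      hind, ih]
    ring

end Independence

/-! ### Exponential and Poisson probabilities. -/

section Laws

theorem expMeasure_one_Iic_pos {x : ℝ} (hx : 0 < x) : 0 < expMeasure 1 (Set.Iic x) := by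
  have := isProbabilityMeasure_expMeasure (r := 1) one_pos
  rw [← ofReal_cdf, cdf_expMeasure_eq one_pos, ENNReal.ofReal_pos, if_pos hx.le]
  simpa using hx

theorem expMeasure_one_Ioi_pos {x : ℝ} (hx : 0 ≤ x) : 0 < expMeasure 1 (Set.Ioi x) := by
  have := isProbabilityMeasure_expMeasure (r := 1) one_pos
  rw [← Set.compl_Iic, prob_compl_eq_one_sub measurableSet_Iic, tsub_pos_iff_lt, ← ofReal_cdf,
    cdf_expMeasure_eq one_pos, if_pos hx, ENNReal.ofReal_lt_one]
  simpa using Real.exp_pos _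

theorem tendsto_poissonMeasure_Ioi (r : ℝ≥0) :
    Tendsto (fun M : ℕ => poissonMeasure r (Set.Ioi M)) atTop (𝓝 0) := by
  have hempty : ⋂ M : ℕ, Set.Ioi M = ∅ := by
    ext n
    simpa using ⟨n, le_rfl⟩
  simpa [hempty, Function.comp_def] using tendsto_measure_iInter_atTop (μ := poissonMeasure r)
    (s := fun M : ℕ => Set.Ioi M) (fun _ => measurableSet_Ioi.nullMeasurableSet)
    (fun _ _ h => Set.Ioi_subset_Ioi h) ⟨0, measure_ne_top _ _⟩

theorem tendsto_poissonMeasure_Iio (K : ℕ) :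
    Tendsto (fun r : ℝ≥0 => poissonMeasure r (Set.Iio K)) atTop (𝓝 0) := by
  have hsum : ∀ r : ℝ≥0, poissonMeasure r (Set.Iio K) =
      ∑ k ∈ Finset.range K, poissonMeasure r {k} := fun r => by
    rw [sum_measure_singleton]
    congr 1
    ext
    simp
  simp_rw [hsum]
  rw [← Finset.sum_const_zero (s := Finset.range K)]
  refine tendsto_finsetSum _ fun k _ => ?_
  simp_rw [poissonMeasure_singleton]
  rw [← ENNReal.ofReal_zero]
  refine ENNReal.tendsto_ofReal ?_
  have h := ((Real.tendsto_pow_mul_exp_neg_atTop_nhds_zero k).comp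
    (NNReal.tendsto_coe_atTop.2 tendsto_id)).div_const (k.factorial : ℝ)
  simpa [Function.comp_def, mul_comm] using h

end Laws

/-! ### Intensity measures of disks and their complements. -/

section Geometry

/-- The mean number of points at distance more than `ρ` from the origin grows without bound. -/
theorem tendsto_diskMean_far (lamE : ℝ≥0) (hlamE : 0 < lamE) (ρ : ℝ) :
    Tendsto (fun D : ℝ => ((lamE • (volume : Measure Plane).restrict (Metric.closedBall 0 D))
      (Metric.closedBall 0 ρ)ᶜ).toNNReal) atTop atTop := by
  set c : ℝ≥0∞ := volume (Metric.closedBall (0 : Plane) ρ) with hc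
  have hctop : c ≠ ∞ := measure_closedBall_lt_top.ne
  have hbound : ∀ D : ℝ, 0 ≤ D → (lamE : ℝ) * (D ^ 2 * Real.pi - c.toReal) ≤
      (((lamE • (volume : Measure Plane).restrict (Metric.closedBall 0 D))
        (Metric.closedBall 0 ρ)ᶜ).toNNReal : ℝ) := fun D hD => by
    have hfin : volume (Metric.closedBall (0 : Plane) D) ≠ ∞ := measure_closedBall_lt_top.ne
    have hvol : (volume (Metric.closedBall (0 : Plane) D)).toReal = D ^ 2 * Real.pi := by
      rw [EuclideanSpace.volume_closedBall_fin_two, ENNReal.toReal_mul, ENNReal.toReal_pow,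
        ENNReal.toReal_ofReal hD, ENNReal.toReal_ofReal Real.pi_pos.le]
    rw [Measure.smul_apply, Measure.restrict_apply measurableSet_closedBall.compl,
      Set.inter_comm, ← Set.sdiff_eq, ENNReal.smul_def, smul_eq_mul, ENNReal.toNNReal_mul,
      ENNReal.toNNReal_coe, NNReal.coe_mul]
    refine mul_le_mul_of_nonneg_left ?_ lamE.2
    have hdiff : volume (Metric.closedBall (0 : Plane) D) - c ≤
        volume (Metric.closedBall (0 : Plane) D \ Metric.closedBall 0 ρ) := le_measure_sdiff
    have hmono := ENNReal.toReal_mono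
      (ne_top_of_le_ne_top hfin (measure_mono Set.sdiff_subset)) hdiff
    -- Truncated subtraction can only enlarge the right side, so `D` and `ρ` need not be compared.
    have hsub := ENNReal.le_toReal_sub (a := volume (Metric.closedBall (0 : Plane) D)) hctop
    rw [hvol] at hsub
    exact hsub.trans hmono
  rw [← NNReal.tendsto_coe_atTop]
  refine tendsto_atTop_mono' atTop ((eventually_ge_atTop 0).mono hbound) ?_
  refine Tendsto.const_mul_atTop (NNReal.coe_pos.2 hlamE) ?_
  exact tendsto_atTop_add_const_right _ _
    ((tendsto_pow_atTop two_ne_zero).atTop_mul_const Real.pi_pos)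

theorem diskMean_closedBall (lam : ℝ≥0) {R D : ℝ} (h : R ≤ D) :
    (lam • (volume : Measure Plane).restrict (Metric.closedBall 0 D)) (Metric.closedBall 0 R) =
      (lam • (volume : Measure Plane)) (Metric.closedBall 0 R) := by
  rw [Measure.smul_apply, Measure.smul_apply, Measure.restrict_apply measurableSet_closedBall,
    Set.inter_eq_left.2 (Metric.closedBall_subset_closedBall h)]

end Geometry

/-! ### Random index sets of points in a region. -/

section Configurations

variable {Ω : Type*}

open Classical in
/-- The indices of the points of a configuration that lie in `A`. -/
noncomputable def pointIndices (N : Ω → ℕ) (X : ℕ → Ω → Plane) (A : Set Plane) (ω : Ω) : Finset ℕ :=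
  (Finset.range (N ω)).filter fun i => X i ω ∈ A

theorem mem_pointIndices {N : Ω → ℕ} {X : ℕ → Ω → Plane} {A : Set Plane} {ω : Ω} {i : ℕ} :
    i ∈ pointIndices N X A ω ↔ i < N ω ∧ X i ω ∈ A := by
  simp [pointIndices]

theorem card_pointIndices (N : Ω → ℕ) (X : ℕ → Ω → Plane) (A : Set Plane) (ω : Ω) :
    (pointIndices N X A ω).card = pointCount N X A ω := by
  rw [pointCount, ← Set.ncard_coe_finset]
  congr 1
  ext i
  simp [mem_pointIndices]

/-- Finite index sets are countable in number, so these events allow conditioning on the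
configuration by a countable partition. -/
theorem measurableSet_pointIndices_eq (N : Ω → ℕ) (X : ℕ → Ω → Plane) {A : Set Plane}
    (hA : MeasurableSet A) (s : Finset ℕ) :
    MeasurableSet[configSigma N X] {ω | pointIndices N X A ω = s} := by
  have hset : {ω | pointIndices N X A ω = s} =
      ⋂ i, {ω | (i < N ω ∧ X i ω ∈ A) ↔ i ∈ s} := by
    ext ω
    simp [Finset.ext_iff, mem_pointIndices]
  rw [hset]
  let _ := configSigma N X
  have hN : Measurable N := measurable_iff_comap_le.2 le_sup_left
  have hX : ∀ i, Measurable (X i) := fun i =>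
    measurable_iff_comap_le.2
      ((le_iSup (fun i => MeasurableSpace.comap (X i) inferInstance) i).trans le_sup_right)
  refine MeasurableSet.iInter fun i => ?_
  have hi : MeasurableSet {ω | i < N ω ∧ X i ω ∈ A} :=
    (hN measurableSet_Ioi).inter (hX i hA)
  exact hi.iff (MeasurableSet.const _)

theorem configSigma_le [mΩ : MeasurableSpace Ω] {P : Measure Ω} {N : Ω → ℕ} {X : ℕ → Ω → Plane}
    {ν : Measure Plane} (h : IsPoissonProcess P N X ν) : configSigma N X ≤ mΩ :=
  sup_le h.measurable_num.comap_le (iSup_le fun i => (h.measurable_point i).comap_le)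

end Configurations

/-! ### Strong signals and the probability of no outage. -/

namespace Network

variable {Ω : Type*} (net : Network Ω)

/-- The signal at the `j`-th eavesdropper exceeds `θ`, and the fading coefficients from the nodes
with index in `s` are at most `1`. -/
def StrongSignal (θ : ℝ) (s : Finset ℕ) (j : ℕ) : Set Ω :=
  net.fadeTx j ⁻¹' Set.Ioi θ ∩ ⋂ i ∈ s, net.fade i j ⁻¹' Set.Iic 1

/-- The factor `‖z‖ ^ (-α)` cancels between signal and interference, which is why the threshold on
the fading is free of the location of `z`. -/
theorem lt_sir_of_mem_strongSignal (Ξ : Policy) {α R₁ R₂ : ℝ} (hα : 0 < α) (hR₁ : 0 < R₁)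
    (hR₂ : R₁ ≤ R₂) (βe : ℝ≥0) {M : ℕ} {s : Finset ℕ} {ω : Ω}
    (hs : pointIndices net.numNodes net.node (Metric.closedBall 0 R₂) ω = s) (hsM : s.card ≤ M)
    {j : ℕ} (hj : 2 * R₂ < ‖net.eave j ω‖)
    (hω : ω ∈ net.StrongSignal (βe * M * 2 ^ α) s j) :
    (βe : ℝ≥0∞) < net.sir Ξ α R₁ R₂ j ω := by
  classical
  set z := net.eave j ω
  set u : ℝ≥0∞ := edist (0 : Plane) z ^ (-α) with hu
  have hz : 0 < ‖z‖ := by linarith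
  have hzne : z ≠ 0 := norm_pos_iff.1 hz
  have hedist : edist (0 : Plane) z = ENNReal.ofReal ‖z‖ := by
    rw [edist_dist, dist_zero_left]
  have hu0 : u ≠ 0 := by
    simp [hu, ENNReal.rpow_eq_zero_iff, hα, hα.not_gt]
  have hutop : u ≠ ∞ := by
    simp [hu, ENNReal.rpow_eq_top_iff, hzne, hα.not_gt, hα]
  have hθ : ENNReal.ofReal (βe * M * 2 ^ α) = βe * (M * 2 ^ α) := by
    rw [mul_assoc, ENNReal.ofReal_mul βe.coe_nonneg, ENNReal.ofReal_mul (Nat.cast_nonneg _),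
      ENNReal.ofReal_natCast, ENNReal.ofReal_coe_nnreal,
      ← ENNReal.ofReal_rpow_of_pos two_pos, ENNReal.ofReal_ofNat]
  have hsignal : βe * (M * 2 ^ α) < ENNReal.ofReal (net.fadeTx j ω) := by
    rw [← hθ]
    have h1 : (βe : ℝ) * M * 2 ^ α < net.fadeTx j ω := hω.1
    exact (ENNReal.ofReal_lt_ofReal_iff_of_nonneg (by positivity)).2 h1
  have hterm : ∀ i ∈ (Finset.range (net.numNodes ω)).filter (net.IsJammer Ξ α R₁ R₂ · ω),
      i ∈ s ∧ ENNReal.ofReal (net.fade i j ω) * edist (net.node i ω) z ^ (-α) ≤ 2 ^ α * u := by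
    intro i hi
    obtain ⟨hiN, hjam⟩ := (Finset.mem_filter.1 hi).2
    have hnorm : ‖net.node i ω‖ ≤ R₂ := by
      rcases hjam with h | ⟨-, h, -⟩
      · exact h.trans hR₂
      · exact h
    have his : i ∈ s := by
      rw [← hs, mem_pointIndices]
      exact ⟨hiN, by simpa using hnorm⟩
    refine ⟨his, ?_⟩
    have hfade : net.fade i j ω ≤ 1 := Set.mem_iInter₂.1 hω.2 i his
    have hdist : edist (0 : Plane) z ≤ 2 * edist (net.node i ω) z := by
      have htwo : 2 * ENNReal.ofReal (dist (net.node i ω) z) =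
          ENNReal.ofReal (2 * dist (net.node i ω) z) := by
        rw [ENNReal.ofReal_mul two_pos.le, ENNReal.ofReal_ofNat]
      rw [hedist, edist_dist, htwo]
      refine ENNReal.ofReal_le_ofReal ?_
      have h2 := norm_sub_norm_le z (net.node i ω)
      rw [dist_comm, dist_eq_norm]
      linarith
    have hrpow : edist (net.node i ω) z ^ (-α) ≤ 2 ^ α * u := by
      have h3 : (2 * edist (net.node i ω) z) ^ (-α) ≤ u := by
        rw [hu, ENNReal.rpow_neg, ENNReal.rpow_neg]
        exact ENNReal.inv_le_inv.2 (ENNReal.rpow_le_rpow hdist hα.le)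
      rw [ENNReal.mul_rpow_of_ne_top (by simp) (edist_ne_top _ _)] at h3
      calc edist (net.node i ω) z ^ (-α)
          = 2 ^ α * (2 ^ (-α) * edist (net.node i ω) z ^ (-α)) := by
            rw [← mul_assoc, ← ENNReal.rpow_add _ _ (by simp) (by simp)]
            simp
        _ ≤ 2 ^ α * u := by gcongr
    calc ENNReal.ofReal (net.fade i j ω) * edist (net.node i ω) z ^ (-α)
        ≤ 1 * (2 ^ α * u) := by
          gcongr
          exact ENNReal.ofReal_le_one.2 hfade
      _ = 2 ^ α * u := one_mul _
  have hI : net.interference Ξ α R₁ R₂ j ω ≤ M * 2 ^ α * u := by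
    calc net.interference Ξ α R₁ R₂ j ω
        ≤ ∑ _i ∈ (Finset.range (net.numNodes ω)).filter (net.IsJammer Ξ α R₁ R₂ · ω),
            2 ^ α * u := Finset.sum_le_sum fun i hi => (hterm i hi).2
      _ ≤ ∑ _i ∈ s, 2 ^ α * u :=
          Finset.sum_le_sum_of_subset fun i hi => (hterm i hi).1
      _ = s.card * (2 ^ α * u) := by rw [Finset.sum_const, nsmul_eq_mul]
      _ ≤ M * (2 ^ α * u) := by gcongr
      _ = M * 2 ^ α * u := (mul_assoc _ _ _).symm
  have hItop : net.interference Ξ α R₁ R₂ j ω ≠ ∞ := by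
    refine ne_top_of_le_ne_top (ENNReal.mul_ne_top (ENNReal.mul_ne_top (by simp) ?_) hutop) hI
    exact ENNReal.rpow_ne_top_of_nonneg hα.le (by simp)
  -- Zero interference is covered here because `βe` is finite.
  rw [sir, ENNReal.lt_div_iff_mul_lt (Or.inr ENNReal.coe_ne_top) (Or.inl hItop)]
  calc (βe : ℝ≥0∞) * net.interference Ξ α R₁ R₂ j ω ≤ βe * (M * 2 ^ α * u) := by gcongr
    _ = βe * (M * 2 ^ α) * u := by ring
    _ < ENNReal.ofReal (net.fadeTx j ω) * u := (ENNReal.mul_lt_mul_iff_left hu0 hutop).2 hsignal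

theorem measurableSet_fadeTx_preimage (j : ℕ) {A : Set ℝ} (hA : MeasurableSet A) :
    MeasurableSet[net.sourceSigma (.fadeTx j)] (net.fadeTx j ⁻¹' A) :=
  ⟨A, hA, rfl⟩

theorem measurableSet_fade_preimage (i j : ℕ) {A : Set ℝ} (hA : MeasurableSet A) :
    MeasurableSet[net.sourceSigma (.fade i j)] (net.fade i j ⁻¹' A) :=
  ⟨A, hA, rfl⟩

/-- The sources are grouped by eavesdropper: the groups are disjoint for distinct `j`, whatever `s`
is. -/
theorem measurableSet_strongSignal (θ : ℝ) (s : Finset ℕ) (j : ℕ) :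
    MeasurableSet[⨆ a ∈ insert (Source.fadeTx j) (Set.range fun i => Source.fade i j),
      net.sourceSigma a] (net.StrongSignal θ s j) := by
  refine MeasurableSet.inter ?_ (Finset.measurableSet_biInter _ fun i _ => ?_)
  · exact le_biSup net.sourceSigma (Set.mem_insert _ _) _
      (net.measurableSet_fadeTx_preimage j measurableSet_Ioi)
  · exact le_biSup net.sourceSigma (Set.mem_insert_of_mem _ (Set.mem_range_self i)) _
      (net.measurableSet_fade_preimage i j measurableSet_Iic)

variable {net} [mΩ : MeasurableSpace Ω] {P : Measure Ω} {lam lamE : ℝ≥0} {D : ℝ}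

theorem IsPoissonNetwork.sourceSigma_le (h : net.IsPoissonNetwork P lam lamE D) (a : Source) :
    net.sourceSigma a ≤ mΩ := by
  cases a with
  | nodes => exact configSigma_le h.nodes_poisson
  | eaves => exact configSigma_le h.eaves_poisson
  | mark i => exact (h.measurable_mark i).comap_le
  | fadeTx j => exact (h.measurable_fadeTx j).comap_le
  | fade i j => exact (h.measurable_fade i j).comap_le

theorem IsPoissonNetwork.measure_strongSignal (h : net.IsPoissonNetwork P lam lamE D) (θ : ℝ)
    (s : Finset ℕ) (j : ℕ) :
    P (net.StrongSignal θ s j) =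
      expMeasure 1 (Set.Ioi θ) * expMeasure 1 (Set.Iic 1) ^ s.card := by
  rw [StrongSignal, measure_inter_biInter_eq_mul_prod h.sourceSigma_le h.indep
    (U := {Source.fadeTx j}) (T := fun i => {Source.fade i j}) (by simp)
    (fun i k hik => by simpa [Function.onFun] using hik)
    (le_biSup net.sourceSigma (Set.mem_singleton (Source.fadeTx j)) _
      (net.measurableSet_fadeTx_preimage j measurableSet_Ioi))
    (fun i => le_biSup net.sourceSigma (Set.mem_singleton (Source.fade i j)) _
      (net.measurableSet_fade_preimage i j measurableSet_Iic))]
  have h1 : P (net.fadeTx j ⁻¹' Set.Ioi θ) = expMeasure 1 (Set.Ioi θ) :=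
    (h.fadeTx_law j).measure_eq (p := (· ∈ Set.Ioi θ)) measurableSet_Ioi
  have h2 : ∀ i, P (net.fade i j ⁻¹' Set.Iic 1) = expMeasure 1 (Set.Iic 1) := fun i =>
    (h.fade_law i j).measure_eq (p := (· ∈ Set.Iic (1 : ℝ))) measurableSet_Iic
  simp [h1, h2]

variable [IsProbabilityMeasure P]

theorem IsPoissonNetwork.measure_inter_iInter_compl_strongSignal_le
    (h : net.IsPoissonNetwork P lam lamE D) (θ : ℝ) {M K : ℕ} {s t : Finset ℕ} (hs : s.card ≤ M)
    (ht : K ≤ t.card) {B : Set Ω}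
    (hB : MeasurableSet[⨆ a ∈ ({Source.nodes, Source.eaves} : Set Source), net.sourceSigma a] B) :
    P (B ∩ ⋂ j ∈ t, (net.StrongSignal θ s j)ᶜ) ≤
      P B * (1 - expMeasure 1 (Set.Ioi θ) * expMeasure 1 (Set.Iic 1) ^ M) ^ K := by
  have := isProbabilityMeasure_expMeasure (r := 1) one_pos
  rw [measure_inter_biInter_eq_mul_prod h.sourceSigma_le h.indep
    (T := fun j => insert (Source.fadeTx j) (Set.range fun i => Source.fade i j)) ?_ ?_ hB
    (fun j => (net.measurableSet_strongSignal θ s j).compl)]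
  · gcongr
    have hj : ∀ j ∈ t, P (net.StrongSignal θ s j)ᶜ ≤
        1 - expMeasure 1 (Set.Ioi θ) * expMeasure 1 (Set.Iic 1) ^ M := fun j _ => by
      rw [prob_compl_eq_one_sub (iSup₂_le (fun a _ => h.sourceSigma_le a) _
        (net.measurableSet_strongSignal θ s j)), h.measure_strongSignal]
      exact tsub_le_tsub_left
        (mul_le_mul_right (pow_le_pow_of_le_one zero_le prob_le_one hs) _) _
    calc ∏ j ∈ t, P (net.StrongSignal θ s j)ᶜ ≤ _ ^ t.card := Finset.prod_le_pow_card _ _ _ hj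
      _ ≤ _ := pow_le_pow_of_le_one zero_le tsub_le_self ht
  · intro j
    simp
  · intro j k hjk
    simp only [Function.onFun]
    rw [Set.disjoint_left]
    rintro a (rfl | ⟨i, rfl⟩) hb <;> simp_all

/-- Without an outage, many nodes are close to the transmitter, or few eavesdroppers are far from
it, or none of many eavesdroppers has a strong signal. -/
theorem IsPoissonNetwork.measure_no_outage_le (h : net.IsPoissonNetwork P lam lamE D) (Ξ : Policy)
    {α R₁ R₂ : ℝ} (hα : 0 < α) (hR₁ : 0 < R₁) (hR₂ : R₁ ≤ R₂) (hD : R₂ ≤ D) (βe : ℝ≥0) (M K : ℕ) :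
    P {ω | ∃ j, j < net.numEaves ω ∧ (βe : ℝ≥0∞) < net.sir Ξ α R₁ R₂ j ω}ᶜ ≤
      poissonMeasure ((lam • (volume : Measure Plane)) (Metric.closedBall 0 R₂)).toNNReal
          (Set.Ioi M) +
        poissonMeasure ((lamE • (volume : Measure Plane).restrict (Metric.closedBall 0 D))
          (Metric.closedBall 0 (2 * R₂))ᶜ).toNNReal (Set.Iio K) +
        (1 - expMeasure 1 (Set.Ioi (βe * M * 2 ^ α)) * expMeasure 1 (Set.Iic 1) ^ M) ^ K := by
  set S := pointIndices net.numNodes net.node (Metric.closedBall 0 R₂)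
  set T := pointIndices net.numEaves net.eave (Metric.closedBall 0 (2 * R₂))ᶜ
  set r := (1 - expMeasure 1 (Set.Ioi (βe * M * 2 ^ α)) * expMeasure 1 (Set.Iic 1) ^ M) ^ K
  -- On each cell both random index sets are frozen, so the independence bound for deterministic `s`
  -- and `t` applies.
  set C : Finset ℕ × Finset ℕ → Set Ω := fun p => {ω | S ω = p.1} ∩ {ω | T ω = p.2}
  have hCmeas : ∀ p, MeasurableSet[⨆ a ∈ ({Source.nodes, Source.eaves} : Set Source),
      net.sourceSigma a] (C p) := fun p => by
    refine MeasurableSet.inter ?_ ?_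
    · exact le_biSup net.sourceSigma (i := Source.nodes) (by simp) _
        (measurableSet_pointIndices_eq _ _ measurableSet_closedBall _)
    · exact le_biSup net.sourceSigma (i := Source.eaves) (by simp) _
        (measurableSet_pointIndices_eq _ _ measurableSet_closedBall.compl _)
  have hnear : P {ω | M < (S ω).card} =
      poissonMeasure ((lam • (volume : Measure Plane)) (Metric.closedBall 0 R₂)).toNNReal
        (Set.Ioi M) := by
    rw [← diskMean_closedBall lam hD]
    simp_rw [S, card_pointIndices]
    exact (h.nodes_poisson.hasLaw_count _ measurableSet_closedBall).measure_eq
      (p := (· ∈ Set.Ioi M)) measurableSet_Ioi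
  have hfar : P {ω | (T ω).card < K} =
      poissonMeasure ((lamE • (volume : Measure Plane).restrict (Metric.closedBall 0 D))
          (Metric.closedBall 0 (2 * R₂))ᶜ).toNNReal (Set.Iio K) := by
    simp_rw [T, card_pointIndices]
    exact (h.eaves_poisson.hasLaw_count _ measurableSet_closedBall.compl).measure_eq
      (p := (· ∈ Set.Iio K)) measurableSet_Iio
  -- The cardinality condition makes `W p` empty on the cells where the bound by `r` is unavailable.
  set W : Finset ℕ × Finset ℕ → Set Ω := fun p =>
    {ω | p.1.card ≤ M ∧ K ≤ p.2.card} ∩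
      (C p ∩ ⋂ j ∈ p.2, (net.StrongSignal (βe * M * 2 ^ α) p.1 j)ᶜ)
  have hW : P (⋃ p, W p) ≤ r := by
    calc P (⋃ p, W p) ≤ ∑' p, P (W p) := measure_iUnion_le _
      _ ≤ ∑' p, P (C p) * r := by
        refine ENNReal.tsum_le_tsum fun p => ?_
        by_cases hp : p.1.card ≤ M ∧ K ≤ p.2.card
        · exact (measure_mono Set.inter_subset_right).trans
            (h.measure_inter_iInter_compl_strongSignal_le _ hp.1 hp.2 (hCmeas p))
        · simp [W, hp]
      _ = P (⋃ p, C p) * r := by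
        rw [ENNReal.tsum_mul_right, measure_iUnion]
        · intro p q hpq
          refine Set.disjoint_left.2 fun ω hp hq => hpq ?_
          exact Prod.ext (hp.1.symm.trans hq.1) (hp.2.symm.trans hq.2)
        · exact fun p => iSup₂_le (fun a _ => h.sourceSigma_le a) _ (hCmeas p)
      _ ≤ 1 * r := by
        gcongr
        exact prob_le_one
      _ = r := one_mul r
  have hsub : {ω | ∃ j, j < net.numEaves ω ∧ (βe : ℝ≥0∞) < net.sir Ξ α R₁ R₂ j ω}ᶜ ⊆
      ({ω | M < (S ω).card} ∪ {ω | (T ω).card < K}) ∪ ⋃ p, W p := by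
    intro ω hω
    by_cases hS : M < (S ω).card
    · exact Or.inl (Or.inl hS)
    by_cases hT : (T ω).card < K
    · exact Or.inl (Or.inr hT)
    refine Or.inr (Set.mem_iUnion.2 ⟨(S ω, T ω), ⟨not_lt.1 hS, not_lt.1 hT⟩, ⟨rfl, rfl⟩, ?_⟩)
    refine Set.mem_iInter₂.2 fun j hj hstrong => hω ?_
    obtain ⟨hjN, hjfar⟩ := mem_pointIndices.1 hj
    exact ⟨j, hjN, net.lt_sir_of_mem_strongSignal Ξ hα hR₁ hR₂ βe rfl (not_lt.1 hS)
      (by simpa using hjfar) hstrong⟩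
  rw [← hnear, ← hfar]
  calc _ ≤ P (({ω | M < (S ω).card} ∪ {ω | (T ω).card < K}) ∪ ⋃ p, W p) := measure_mono hsub
    _ ≤ P ({ω | M < (S ω).card} ∪ {ω | (T ω).card < K}) + P (⋃ p, W p) := measure_union_le _ _
    _ ≤ _ := add_le_add (measure_union_le _ _) hW

end Network

end FriendlyJamming

theorem corollary2
    (α : ℝ) (hα : α = 2 ∨ α = 4)
    (R₁ R₂ : ℝ) (hR₁ : 0 < R₁) (hR₂ : R₁ ≤ R₂)
    (lam lamE βe : ℝ≥0) (hlamE : 0 < lamE)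
    (Ξ : FriendlyJamming.Policy)
    {Ω : ℝ → Type*} [∀ D, MeasurableSpace (Ω D)]
    (P : ∀ D, Measure (Ω D)) [∀ D, IsProbabilityMeasure (P D)]
    (net : ∀ D, FriendlyJamming.Network (Ω D))
    (hnet : ∀ D, R₂ ≤ D → (net D).IsPoissonNetwork (P D) lam lamE D) :
    Tendsto (fun D : ℝ => (net D).sop (P D) Ξ α R₁ R₂ βe) atTop (𝓝 1) := by
  open FriendlyJamming in
  have hα0 : 0 < α := by rcases hα with rfl | rfl <;> norm_num
  have := isProbabilityMeasure_expMeasure (r := 1) one_pos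
  set E : ∀ D, Set (Ω D) := fun D =>
    {ω | ∃ j, j < (net D).numEaves ω ∧ (βe : ℝ≥0∞) < (net D).sir Ξ α R₁ R₂ j ω} with hE
  have hcompl : Tendsto (fun D => P D (E D)ᶜ) atTop (𝓝 0) := by
    rw [ENNReal.tendsto_nhds_zero]
    intro ε hε
    have hε3 : 0 < ε / 3 := ENNReal.div_pos hε.ne' (by simp)
    -- The order of choice matters: `M` fixes the success probability per eavesdropper, `K` then
    -- depends on `M`, and `D` on both.
    obtain ⟨M, hM⟩ := ((ENNReal.tendsto_nhds_zero.1 (tendsto_poissonMeasure_Ioi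
      ((lam • (volume : Measure Plane)) (Metric.closedBall 0 R₂)).toNNReal)) _ hε3).exists
    have hr : 1 - expMeasure 1 (Set.Ioi (βe * M * 2 ^ α)) * expMeasure 1 (Set.Iic 1) ^ M < 1 := by
      refine ENNReal.sub_lt_self (by simp) one_ne_zero (mul_ne_zero ?_ (pow_ne_zero _ ?_))
      · exact (expMeasure_one_Ioi_pos (by positivity)).ne'
      · exact (expMeasure_one_Iic_pos one_pos).ne'
    obtain ⟨K, hK⟩ := ((ENNReal.tendsto_nhds_zero.1
      (ENNReal.tendsto_pow_atTop_nhds_zero_of_lt_one hr)) _ hε3).exists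
    filter_upwards [eventually_ge_atTop R₂, (ENNReal.tendsto_nhds_zero.1
      ((tendsto_poissonMeasure_Iio K).comp (tendsto_diskMean_far lamE hlamE (2 * R₂)))) _ hε3]
      with D hD hfar
    calc P D (E D)ᶜ ≤ _ := (hnet D hD).measure_no_outage_le Ξ hα0 hR₁ hR₂ hD βe M K
      _ ≤ ε / 3 + ε / 3 + ε / 3 := add_le_add (add_le_add hM hfar) hK
      _ = ε := ENNReal.add_thirds ε
  have hreal : Tendsto (fun D => 1 - (P D).real (E D)ᶜ) atTop (𝓝 1) := by
    have h0 := (ENNReal.tendsto_toReal ENNReal.zero_ne_top).comp hcompl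
    simpa [Function.comp_def, Measure.real] using h0.const_sub 1
  -- Subadditivity gives `1 - P Eᶜ ≤ P E` without measurability of `E`.
  refine tendsto_of_tendsto_of_tendsto_of_le_of_le hreal tendsto_const_nhds (fun D => ?_)
    fun D => measureReal_le_one
  have h1 := measureReal_union_le (μ := P D) (E D) (E D)ᶜ
  rw [Set.union_compl_self, probReal_univ] at h1
  exact sub_le_iff_le_add.2 h1
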